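/- For $n\ge 5$ let $\mathcal{NB}_n$ be the necklace braid group, given by its presentation with generators $\sigma_1,\dots,\sigma_n,\tau$ and relations (indices modulo $n$) $$\sigma_i\sigma_{i+1}\sigma_i=\sigma_{i+1}\sigma_i\sigma_{i+1},\qquad \sigma_i\sigma_j=\sigma_j\sigma_i\ \ (i-j\not\equiv\pm1 \bmod n),\qquad \tau\sigma_i\tau^{-1}=\sigma_{i+1},\qquad \tau^{2n}=1,$$ and let $\mathcal{B}_n$ be Artin's braid group on $n$ strands. Representations are over $\mathbb{C}$. Let $n\ge 5$. Every irreducible finite-dimensional representation of $\mathcal{NB}_n$ of dimension at most $n-3$ is $1$-dimensional. Thus $\mathcal{NB}_n$ has the same gap in its irreducible degrees as $\mathcal{B}_n$: for $2\le d\le n-3$, neither $\mathcal{NB}_n$ nor $\mathcal{B}_n$ has an irreducible representation of dimension $d$. -/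

import Mathlib

/-- Generators of the necklace braid group: `sigma i` for `i` modulo `n`, and `tau`. The residue
class of `n` (that is, `0 : ZMod n`) is the index of the generator usually written `σ_n`. -/
inductive NecklaceGen (n : ℕ) : Type
  | sigma (i : ZMod n) : NecklaceGen n
  | tau : NecklaceGen n

namespace NecklaceGen

/-- The letter `σ_i` in the free group on the generators. -/
def s {n : ℕ} (i : ZMod n) : FreeGroup (NecklaceGen n) := FreeGroup.of (sigma i)

/-- The letter `τ` in the free group on the generators. -/
def t {n : ℕ} : FreeGroup (NecklaceGen n) := FreeGroup.of tau

end NecklaceGen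

open NecklaceGen in
/-- The defining relators of the necklace braid group, all indices being taken modulo `n`. -/
inductive NecklaceRel (n : ℕ) : FreeGroup (NecklaceGen n) → Prop
  /-- `σ_i σ_{i+1} σ_i = σ_{i+1} σ_i σ_{i+1}` -/
  | braid (i : ZMod n) :
      NecklaceRel n (s i * s (i + 1) * s i * (s (i + 1) * s i * s (i + 1))⁻¹)
  /-- `σ_i σ_j = σ_j σ_i` whenever `i - j ≢ ±1` modulo `n` -/
  | comm (i j : ZMod n) (h₁ : i - j ≠ 1) (h₂ : j - i ≠ 1) :
      NecklaceRel n (s i * s j * (s j * s i)⁻¹)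
  /-- `τ σ_i τ⁻¹ = σ_{i+1}` -/
  | conj (i : ZMod n) : NecklaceRel n (t * s i * t⁻¹ * (s (i + 1))⁻¹)
  /-- `τ ^ (2 n) = 1` -/
  | tors : NecklaceRel n (t ^ (2 * n))

/-- The necklace braid group `NB_n`. -/
abbrev NecklaceBraidGroup (n : ℕ) : Type :=
  PresentedGroup {r : FreeGroup (NecklaceGen n) | NecklaceRel n r}

/-- The defining relators of Artin's braid group on `n` strands; its generators
`σ_1, …, σ_{n-1}` are indexed by `Fin (n - 1)` (so the index is shifted by one). -/
inductive ArtinRel (n : ℕ) : FreeGroup (Fin (n - 1)) → Prop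
  /-- `σ_i σ_j σ_i = σ_j σ_i σ_j` for `j = i + 1` -/
  | braid (i j : Fin (n - 1)) (h : (j : ℕ) = (i : ℕ) + 1) :
      ArtinRel n (FreeGroup.of i * FreeGroup.of j * FreeGroup.of i *
        (FreeGroup.of j * FreeGroup.of i * FreeGroup.of j)⁻¹)
  /-- `σ_i σ_j = σ_j σ_i` for `j ≥ i + 2` -/
  | comm (i j : Fin (n - 1)) (h : (i : ℕ) + 2 ≤ (j : ℕ)) :
      ArtinRel n (FreeGroup.of i * FreeGroup.of j * (FreeGroup.of j * FreeGroup.of i)⁻¹)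

/-- Artin's braid group `B_n` on `n` strands. -/
abbrev ArtinBraidGroup (n : ℕ) : Type :=
  PresentedGroup {r : FreeGroup (Fin (n - 1)) | ArtinRel n r}

/-- `d` is the dimension of some irreducible complex representation of `G`. -/
def IsIrreducibleDegree (G : Type*) [Group G] (d : ℕ) : Prop :=
  ∃ ρ : Representation ℂ G (Fin d → ℂ), ρ.IsIrreducible

/-!
A representation of `B_n` or `NB_n` of dimension `d ≤ n - 3` has commutative image, so it is
`1`-dimensional if irreducible (`Representation.IsIrreducible.finrank_eq_one_of_commute`). For both
groups this comes from `IsBraidTuple.eq_of_finrank_add_two_le`: invertible operators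
`x 0, …, x (m - 1)` satisfying the braid relations on a space of dimension `d ≤ m - 2` are all equal.
In `NB_n` the generators `σ_0, …, σ_{n-2}` give such operators with `m = n - 1`; since `τ` permutes
the `σ_i` cyclically, the last one equals the others too, and `τ` commutes with their common value.

The equality is proved by induction on `d`. A first tool is propagation: if two of the operators, or
two submodules attached to them in a conjugation-equivariant way, coincide, then they all do
(`eq_of_eq_succ`, `apply_eq_of_apply_eq`). A second is gluing (`eq_of_agree`): for `4 ≤ m`, operators
that agree on an invariant subspace and on its quotient are equal. Let `k` be the dimension of an
eigenspace of `x 0` for `μ`.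

* If `2 ≤ k ≤ d - 2`, the operators `x 2, x 3, …` preserve it, and the induction hypothesis for it and
  for its quotient gives `x 2 = x 3`.
* If `k = d`, then `x 0` is central.
* If `k = d - 1`, the operators `a i = x i - μ` have rank one. If two have the same image, all have,
  and this line is invariant with the `x i` acting as `μ` on the quotient. If not, then `a i * a j = 0`
  for distant `i`, `j` and `a i * a (i + 1) ≠ 0`, which yields a chain of more than `d + 1` subspaces
  (`le_finrank_of_mul_eq_zero`).
* If every nonzero eigenspace is a line, an eigenline of `x 0` is also an eigenspace of `x 2` and of
  `x 3`, for one scalar, so the corresponding eigenlines of all `x i` coincide. This line is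
  invariant, and the induction hypothesis applies to the quotient.
-/

universe u

section BraidTuples

open Module

variable {K : Type*} [Field K] {V : Type u} [AddCommGroup V] [Module K V]

/-! ### Linear algebra of pairs and sequences of endomorphisms -/

/-- For commuting units the braid relation reads `x² y = x y²`. -/
theorem eq_of_braid_of_commute {M : Type*} [Monoid M] {x y : M} (hx : IsUnit x) (hy : IsUnit y)
    (h : x * y * x = y * x * y) (hc : Commute x y) : x = y := by
  have h1 : x * (x * y) = x * (y * y) := by
    calc x * (x * y) = x * y * x := by rw [mul_assoc, hc.eq]
      _ = y * x * y := h
      _ = x * (y * y) := by rw [← hc.eq, mul_assoc]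
  exact hy.mul_right_cancel (hx.mul_left_cancel h1)

/-- A nonzero product `a * b = b * a` of rank one operators has image equal to that of `a` and,
read in the other order, to that of `b`. -/
theorem LinearMap.range_eq_range_of_commute_of_mul_ne_zero [FiniteDimensional K V]
    {a b : End K V} (h : Commute a b) (ha : finrank K (LinearMap.range a) = 1)
    (hb : finrank K (LinearMap.range b) = 1) (hab : a * b ≠ 0) :
    LinearMap.range a = LinearMap.range b := by
  have key : ∀ {a b : End K V}, finrank K (LinearMap.range a) = 1 → a * b ≠ 0 →
      LinearMap.range (a * b) = LinearMap.range a := by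
    intro a b ha hab
    refine Submodule.eq_of_le_of_finrank_le (LinearMap.range_comp_le_range b a) ?_
    rw [ha, Nat.succ_le_iff, Nat.pos_iff_ne_zero, Ne, Submodule.finrank_eq_zero,
      LinearMap.range_eq_bot]
    exact hab
  rw [← key ha hab, ← key hb (h.eq ▸ hab), h.eq]

theorem LinearMap.commute_of_finrank_le_one [FiniteDimensional K V]
    (hV : finrank K V ≤ 1) (a b : End K V) : Commute a b := by
  obtain ⟨v, hv⟩ := finrank_le_one_iff.1 hV
  obtain ⟨c, hc⟩ := hv (a v)
  obtain ⟨d, hd⟩ := hv (b v)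
  refine LinearMap.ext fun w ↦ ?_
  obtain ⟨e, rfl⟩ := hv w
  simp only [End.mul_apply, map_smul, ← hc, ← hd, smul_comm c d]

/-- The common kernels of the first `k` operators decrease strictly for `k < m`: an image vector
of `a (k + 1)` not killed by `a k` is killed by all `a i` with `i < k`. -/
theorem le_finrank_of_mul_eq_zero [FiniteDimensional K V] {m : ℕ} {a : ℕ → End K V}
    (h0 : ∀ i j, i + 2 ≤ j → j < m → a i * a j = 0)
    (h1 : ∀ i, i + 1 < m → a i * a (i + 1) ≠ 0) : m ≤ finrank K V + 1 := by
  have key : ∀ k, k < m →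
      finrank K (⨅ i ∈ Finset.range k, LinearMap.ker (a i) : Submodule K V) + k ≤ finrank K V := by
    intro k
    induction k with
    | zero => exact fun _ ↦ Submodule.finrank_le _
    | succ k ih =>
      intro hk
      refine le_trans ?_ (ih (by omega))
      have hlt : (⨅ i ∈ Finset.range (k + 1), LinearMap.ker (a i) : Submodule K V) <
          ⨅ i ∈ Finset.range k, LinearMap.ker (a i) := by
        refine lt_of_le_of_ne (biInf_mono fun i hi ↦ ?_) fun heq ↦ h1 k hk ?_
        · exact Finset.mem_range.2 ((Finset.mem_range.1 hi).trans k.lt_succ_self)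
        · refine LinearMap.ext fun w ↦ ?_
          have hw : a (k + 1) w ∈ (⨅ i ∈ Finset.range k, LinearMap.ker (a i) : Submodule K V) := by
            simp only [Submodule.mem_iInf, Finset.mem_range, LinearMap.mem_ker]
            exact fun i hi ↦ LinearMap.congr_fun (h0 i (k + 1) (by omega) hk) w
          rw [← heq] at hw
          simp only [Submodule.mem_iInf, Finset.mem_range, LinearMap.mem_ker] at hw
          exact hw k k.lt_succ_self
      have := Submodule.finrank_lt_finrank_of_lt hlt
      omega
  rcases m with _ | m
  · omega
  · have := key m m.lt_succ_self
    omega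

/-- For `a = x - μ` and `b = y - μ` with `a * b = 0`, the braid relation reduces to
`μ • (a * x) = μ • (b * y)`, whose two sides have the images of `a` and of `b`. -/
theorem range_sub_eq_of_braid [FiniteDimensional K V] {x y : End K V} {μ : K} (hμ : μ ≠ 0)
    (hx : IsUnit x) (hy : IsUnit y) (h : x * y * x = y * x * y)
    (h0 : (x - μ • (1 : End K V)) * (y - μ • (1 : End K V)) = 0) :
    LinearMap.range (x - μ • (1 : End K V)) = LinearMap.range (y - μ • (1 : End K V)) := by
  obtain ⟨a, rfl⟩ : ∃ a, x = a + μ • (1 : End K V) := ⟨x - μ • (1 : End K V), by simp⟩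
  obtain ⟨b, rfl⟩ : ∃ b, y = b + μ • (1 : End K V) := ⟨y - μ • (1 : End K V), by simp⟩
  simp only [add_sub_cancel_right] at h0 ⊢
  have h1 : μ • (a * (a + μ • (1 : End K V))) = μ • (b * (b + μ • (1 : End K V))) := by
    have e : b * a * b = 0 := by rw [mul_assoc, h0, mul_zero]
    simp only [add_mul, mul_add, smul_mul_assoc, mul_smul_comm, one_mul, mul_one, e, h0,
      zero_mul, smul_zero, smul_add] at h ⊢
    linear_combination (norm := module) h
  have h2 : a * (a + μ • (1 : End K V)) = b * (b + μ • (1 : End K V)) := smul_right_injective _ hμ h1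
  have key : ∀ {a x : End K V}, IsUnit x → LinearMap.range (a * x) = LinearMap.range a :=
    fun hx ↦ LinearMap.range_comp_of_range_eq_top _
      ((LinearMap.isUnit_iff_range_eq_top _).1 hx)
  rw [← key hx, h2, key hy]

/-! ### Submodules attached naturally to endomorphisms -/

/-- An assignment of a submodule to each endomorphism that is equivariant under conjugation.
Conjugation of `x` into `y` by a unit `g` is written `g * x = y * g`. -/
def IsConjNatural (F : End K V → Submodule K V) : Prop :=
  ∀ g x y : End K V, IsUnit g → g * x = y * g → F y = (F x).map g

theorem isConjNatural_eigenspace (μ : K) :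
    IsConjNatural (V := V) fun x : End K V ↦ End.eigenspace x μ := by
  intro g x y hg h
  have hinj : Function.Injective g := ((End.isUnit_iff g).1 hg).injective
  have hsurj : Function.Surjective g := ((End.isUnit_iff g).1 hg).surjective
  have h' : ∀ v, g (x v) = y (g v) := fun v ↦ LinearMap.congr_fun h v
  ext w
  obtain ⟨v, rfl⟩ := hsurj w
  simp only [Submodule.mem_map, End.mem_eigenspace_iff]
  constructor
  · intro hv
    exact ⟨v, hinj (by rw [h', hv, map_smul]), rfl⟩
  · rintro ⟨v', hv', hvv⟩
    rw [← hvv, ← h', hv', map_smul]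

theorem isConjNatural_range_sub (μ : K) :
    IsConjNatural (V := V) fun x : End K V ↦ LinearMap.range (x - μ • (1 : End K V)) := by
  intro g x y hg h
  have hsurj : Function.Surjective g := ((End.isUnit_iff g).1 hg).surjective
  have h' : g * (x - μ • (1 : End K V)) = (y - μ • (1 : End K V)) * g := by
    rw [mul_sub, sub_mul, h, mul_smul_comm, smul_mul_assoc, mul_one, one_mul]
  change LinearMap.range (y - μ • (1 : End K V)) = _
  rw [← LinearMap.range_comp, ← Module.End.mul_eq_comp, h', Module.End.mul_eq_comp,
    LinearMap.range_comp_of_range_eq_top _ (LinearMap.range_eq_top.2 hsurj)]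

namespace IsConjNatural

variable {F : End K V → Submodule K V}

theorem map_self (hF : IsConjNatural F) {g : End K V} (hg : IsUnit g) : (F g).map g = F g :=
  (hF g g g hg rfl).symm

theorem map_of_commute (hF : IsConjNatural F) {g x : End K V} (hg : IsUnit g)
    (h : Commute g x) : (F x).map g = F x :=
  (hF g x x hg h).symm

theorem eq_map_of_braid (hF : IsConjNatural F) {x y : End K V} (hx : IsUnit x) (hy : IsUnit y)
    (h : x * y * x = y * x * y) : F y = ((F x).map y).map x := by
  rw [hF (x * y) x y (hx.mul hy) (by rw [h, mul_assoc]), End.mul_eq_comp, Submodule.map_comp]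

theorem eq_of_commute_of_braid (hF : IsConjNatural F) {x y z : End K V} (hy : IsUnit y)
    (hz : IsUnit z) (hxy : Commute x y) (hxz : Commute x z) (hyz : y * z * y = z * y * z)
    (h : F x = F y) : F y = F z := by
  rw [hF.eq_map_of_braid hy hz hyz, ← h, hF.map_of_commute hz hxz.symm,
    hF.map_of_commute hy hxy.symm]

theorem eq_of_braid_of_braid (hF : IsConjNatural F) {x y z : End K V} (hy : IsUnit y)
    (hz : IsUnit z) (hxz : Commute x z) (hyz : y * z * y = z * y * z)
    (h : F x = F y) : F y = F z := by
  rw [hF.eq_map_of_braid hy hz hyz, ← h, hF.map_of_commute hz hxz.symm, h, hF.map_self hy]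

end IsConjNatural

/-! ### Families of operators satisfying the braid relations -/

/-- The operators `x 0, …, x (m - 1)` are invertible and satisfy the braid relations of the
Artin generators of the braid group on `m + 1` strands. The sequence is continued by `1` beyond
index `m - 1`, so that invertibility, commutation and invariance of subspaces need no bound on
the index, and restriction to a subspace can be made termwise. -/
structure IsBraidTuple (m : ℕ) (x : ℕ → End K V) : Prop where
  isUnit : ∀ i, IsUnit (x i)
  braid : ∀ i, i + 1 < m → x i * x (i + 1) * x i = x (i + 1) * x i * x (i + 1)
  comm : ∀ i j, i + 2 ≤ j → Commute (x i) (x j)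
  eq_one : ∀ i, m ≤ i → x i = 1

theorem forall_of_iff_succ {m : ℕ} {P : ℕ → Prop} (h : ∀ i, i + 2 < m → (P i ↔ P (i + 1)))
    {i j : ℕ} (hi : i + 1 < m) (hP : P i) (hj : j + 1 < m) : P j := by
  have key : ∀ k, k + 1 < m → (P k ↔ P 0) := by
    intro k
    induction k with
    | zero => simp
    | succ k ih => exact fun hk ↦ (h k hk).symm.trans (ih (by omega))
  exact (key j hj).2 ((key i hi).1 hP)

theorem eq_zero_of_eq_succ {α : Type*} {m : ℕ} {f : ℕ → α}
    (h : ∀ i, i + 1 < m → f i = f (i + 1)) : ∀ i, i < m → f i = f 0 := by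
  intro i
  induction i with
  | zero => simp
  | succ i ih => exact fun hi ↦ (h i hi).symm.trans (ih (by omega))

namespace IsBraidTuple

variable {m : ℕ} {x : ℕ → End K V}

theorem shift_two (hx : IsBraidTuple m x) : IsBraidTuple (m - 2) fun i ↦ x (i + 2) where
  isUnit i := hx.isUnit _
  braid i hi := hx.braid (i + 2) (by omega)
  comm i j hij := hx.comm _ _ (by omega)
  eq_one i hi := hx.eq_one _ (by omega)

theorem restrict [FiniteDimensional K V] (hx : IsBraidTuple m x) {W : Submodule K V}
    (hW : ∀ i, ∀ w ∈ W, x i w ∈ W) : IsBraidTuple m fun i ↦ (x i).restrict (hW i) where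
  isUnit i := by
    rw [LinearMap.isUnit_iff_ker_eq_bot, LinearMap.ker_eq_bot]
    intro v w h
    exact Subtype.ext (((End.isUnit_iff _).1 (hx.isUnit i)).injective (congrArg Subtype.val h))
  braid i hi := LinearMap.ext fun w ↦
    Subtype.ext (LinearMap.congr_fun (hx.braid i hi) (w : V))
  comm i j hij := LinearMap.ext fun w ↦
    Subtype.ext (LinearMap.congr_fun (hx.comm i j hij) (w : V))
  eq_one i hi := LinearMap.ext fun w ↦
    Subtype.ext (LinearMap.congr_fun (hx.eq_one i hi) (w : V))

theorem mapQ [FiniteDimensional K V] (hx : IsBraidTuple m x) {W : Submodule K V}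
    (hW : ∀ i, ∀ w ∈ W, x i w ∈ W) : IsBraidTuple m fun i ↦ W.mapQ W (x i) (hW i) where
  isUnit i := by
    rw [LinearMap.isUnit_iff_range_eq_top, LinearMap.range_eq_top]
    intro v
    obtain ⟨v, rfl⟩ := W.mkQ_surjective v
    obtain ⟨w, rfl⟩ := ((End.isUnit_iff _).1 (hx.isUnit i)).surjective v
    exact ⟨W.mkQ w, rfl⟩
  braid i hi := Submodule.linearMap_qext _ <| LinearMap.ext fun w ↦
    congrArg W.mkQ (LinearMap.congr_fun (hx.braid i hi) (w : V))
  comm i j hij := Submodule.linearMap_qext _ <| LinearMap.ext fun w ↦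
    congrArg W.mkQ (LinearMap.congr_fun (hx.comm i j hij) (w : V))
  eq_one i hi := Submodule.linearMap_qext _ <| LinearMap.ext fun w ↦
    congrArg W.mkQ (LinearMap.congr_fun (hx.eq_one i hi) (w : V))

/-- If two neighbours coincide, the next operator commutes with both, hence equals them by the
braid relation; so coincidence spreads along the whole tuple. -/
theorem eq_of_eq_succ (hx : IsBraidTuple m x) {i : ℕ} (hi : i + 1 < m)
    (h : x i = x (i + 1)) : ∀ j, j < m → x j = x 0 := by
  refine eq_zero_of_eq_succ fun j hj ↦ forall_of_iff_succ (P := fun k ↦ x k = x (k + 1)) ?_ hi h hj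
  intro k hk
  have hc := hx.comm k (k + 2) le_rfl
  constructor
  · intro h
    rw [h] at hc
    exact eq_of_braid_of_commute (hx.isUnit _) (hx.isUnit _) (hx.braid (k + 1) hk) hc
  · intro h
    rw [show x (k + 2) = x (k + 1) from h.symm] at hc
    exact eq_of_braid_of_commute (hx.isUnit _) (hx.isUnit _) (hx.braid k (by omega)) hc

/-- The propagation of `eq_of_eq_succ` for submodules attached naturally to the operators. -/
theorem apply_eq_of_eq_succ (hx : IsBraidTuple m x) {F : End K V → Submodule K V}
    (hF : IsConjNatural F) {i : ℕ} (hi : i + 1 < m) (h : F (x i) = F (x (i + 1))) :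
    ∀ j, j < m → F (x j) = F (x 0) := by
  refine eq_zero_of_eq_succ (f := fun j ↦ F (x j)) fun j hj ↦
    forall_of_iff_succ (P := fun k ↦ F (x k) = F (x (k + 1))) ?_ hi h hj
  intro k hk
  have hc := hx.comm k (k + 2) le_rfl
  constructor
  · exact fun h ↦ hF.eq_of_braid_of_braid (hx.isUnit _) (hx.isUnit _) hc
      (hx.braid (k + 1) hk) h
  · exact fun h ↦ (hF.eq_of_braid_of_braid (hx.isUnit _) (hx.isUnit _) hc.symm
      (hx.braid k (by omega)).symm h.symm).symm

/-- A coincidence between any two members can be moved to neighbours: with room for a third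
operator `z` next to one of the two and far from the other, conjugation by `y * z` takes `y` to `z`
and fixes the other. -/
theorem apply_eq_of_apply_eq (hx : IsBraidTuple m x) (hm : 4 ≤ m) {F : End K V → Submodule K V}
    (hF : IsConjNatural F) {i j : ℕ} (hij : i < j) (hj : j < m) (h : F (x i) = F (x j)) :
    ∀ k, k < m → F (x k) = F (x 0) := by
  rcases Nat.lt_or_ge j (i + 2) with h2 | h2
  · obtain rfl : j = i + 1 := by omega
    exact hx.apply_eq_of_eq_succ hF hj h
  have hc := hx.comm i j h2
  by_cases hj' : j + 1 < m
  · exact hx.apply_eq_of_eq_succ hF hj' (hF.eq_of_commute_of_braid (hx.isUnit _) (hx.isUnit _)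
      hc (hx.comm _ _ (by omega)) (hx.braid j hj') h)
  rcases i with _ | i
  · obtain ⟨j, rfl⟩ : ∃ k, j = k + 1 := ⟨j - 1, by omega⟩
    exact hx.apply_eq_of_eq_succ hF hj (hF.eq_of_commute_of_braid (hx.isUnit _) (hx.isUnit _)
      hc (hx.comm _ _ (by omega)) (hx.braid j hj).symm h).symm
  · exact hx.apply_eq_of_eq_succ hF (i := i) (by omega)
      (hF.eq_of_commute_of_braid (hx.isUnit _) (hx.isUnit _)
      hc.symm (hx.comm _ _ (by omega)).symm (hx.braid i (by omega)).symm h.symm).symm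

/-- The members of a braid tuple are conjugate, by `x i * x (i + 1)` for neighbours. -/
theorem finrank_apply_eq (hx : IsBraidTuple m x) {F : End K V → Submodule K V}
    (hF : IsConjNatural F) : ∀ i, i < m → finrank K (F (x i)) = finrank K (F (x 0)) := by
  refine eq_zero_of_eq_succ (f := fun i ↦ finrank K (F (x i))) fun i hi ↦ ?_
  have h := hF (x i * x (i + 1)) (x i) (x (i + 1)) ((hx.isUnit _).mul (hx.isUnit _))
    (by rw [hx.braid i hi, mul_assoc])
  have hinj := ((End.isUnit_iff _).1 ((hx.isUnit i).mul (hx.isUnit (i + 1)))).injective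
  rw [h]
  exact LinearEquiv.finrank_eq (Submodule.equivMapOfInjective _ hinj _)

/-- Gluing along an invariant subspace: `D = x 2 - x 3` kills `W` and has image in `W`, so
`x 2` and `x 0` have the same products with `D` on either side. As `x 0` commutes with `D`, so does
`x 2`; hence `x 2` and `x 3` commute and the braid relation makes them equal. This takes the place
of the perfectness of the commutator subgroup of the braid group. -/
theorem eq_of_agree (hx : IsBraidTuple m x) (hm : 4 ≤ m) {W : Submodule K V}
    (hsub : ∀ i < m, ∀ w ∈ W, x i w = x 0 w) (hquot : ∀ i < m, ∀ v, x i v - x 0 v ∈ W) :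
    ∀ i, i < m → x i = x 0 := by
  have hD : ∀ v, x 2 v - x 3 v ∈ W := fun v ↦ by
    have := W.sub_mem (hquot 2 (by omega) v) (hquot 3 (by omega) v)
    rwa [sub_sub_sub_cancel_right] at this
  have hker : ∀ w ∈ W, x 2 w = x 3 w := fun w hw ↦
    (hsub 2 (by omega) w hw).trans (hsub 3 (by omega) w hw).symm
  have hc2 : ∀ v, x 0 (x 2 v) = x 2 (x 0 v) := LinearMap.congr_fun (hx.comm 0 2 (by omega))
  have hc3 : ∀ v, x 0 (x 3 v) = x 3 (x 0 v) := LinearMap.congr_fun (hx.comm 0 3 (by omega))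
  have hc : Commute (x 2) (x 3) := LinearMap.ext fun v ↦ by
    have h1 := hsub 2 (by omega) _ (hD v)
    have h2 := hker _ (hquot 2 (by omega) v)
    simp only [map_sub, hc2, hc3] at h1 h2
    change x 2 (x 3 v) = x 3 (x 2 v)
    linear_combination (norm := module) h2 - h1
  exact hx.eq_of_eq_succ (i := 2) (by omega)
    (eq_of_braid_of_commute (hx.isUnit _) (hx.isUnit _) (hx.braid 2 (by omega)) hc)

theorem eq_of_finrank_le_one [FiniteDimensional K V] (hx : IsBraidTuple m x)
    (hV : finrank K V ≤ 1) : ∀ i, i < m → x i = x 0 :=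
  eq_zero_of_eq_succ fun i hi ↦ eq_of_braid_of_commute (hx.isUnit _) (hx.isUnit _)
    (hx.braid i hi) (LinearMap.commute_of_finrank_le_one hV _ _)

/-! ### Small dimension forces equality -/

/-- The low-dimensional rigidity of the braid relations, by induction on the dimension `d`,
according to the dimensions of the eigenspaces of `x 0`. -/
theorem eq_of_finrank_add_two_le [IsAlgClosed K] (d : ℕ) : ∀ (V : Type u) [AddCommGroup V]
    [Module K V] [FiniteDimensional K V] (m : ℕ) (x : ℕ → End K V), finrank K V = d → d + 2 ≤ m →
    IsBraidTuple m x → ∀ i, i < m → x i = x 0 := by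
  induction d using Nat.strong_induction_on with | _ d ih => ?_
  intro V _ _ _ m x hV hm hx
  rcases Nat.lt_or_ge d 2 with hd | hd
  · exact hx.eq_of_finrank_le_one (by omega)
  -- a nonzero invariant subspace on which the `y i` agree suffices: its quotient has smaller dimension
  have glue : ∀ (k : ℕ) (y : ℕ → End K V) (W : Submodule K V), IsBraidTuple k y →
      4 ≤ k → (∀ i, ∀ w ∈ W, y i w ∈ W) → 0 < finrank K W → d - finrank K W + 2 ≤ k →
      (∀ i < k, ∀ w ∈ W, y i w = y 0 w) → ∀ i, i < k → y i = y 0 := by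
    intro k y W hy hk hW hpos hle hsub
    have hq := W.finrank_quotient_add_finrank
    refine hy.eq_of_agree hk hsub fun i hi v ↦ ?_
    have := LinearMap.congr_fun (ih (d - finrank K W) (by omega) (V ⧸ W) k _ (by omega) hle
      (hy.mapQ hW) i hi) (W.mkQ v)
    exact (Submodule.Quotient.eq W).1 this
  have hnat := isConjNatural_eigenspace (V := V) (K := K)
  have hinv : ∀ μ, ∀ g : End K V, Commute g (x 0) → ∀ w ∈ End.eigenspace (x 0) μ,
      g w ∈ End.eigenspace (x 0) μ := by
    intro μ g hg w hw
    rw [End.mem_eigenspace_iff] at hw ⊢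
    rw [← map_smul, ← hw]
    exact (LinearMap.congr_fun hg.eq w).symm
  by_contra hne
  -- eigenspaces of dimension at least `2` are excluded
  have hone : ∀ i < m, ∀ μ, finrank K (End.eigenspace (x i) μ) ≤ 1 := by
    intro i hi μ
    rw [hx.finrank_apply_eq (hnat μ) i hi]
    by_contra! hk
    have hkd : finrank K (End.eigenspace (x 0) μ) ≤ d := hV ▸ Submodule.finrank_le _
    rcases Nat.lt_or_ge (finrank K (End.eigenspace (x 0) μ) + 1) d with hlt | hge
    · -- all `x i` with `2 ≤ i` preserve the eigenspace, and the induction hypothesis applies to it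
      -- and to its quotient, both of dimension at most `d - 2`
      have hm' : 4 ≤ m - 2 := by omega
      have hWinv : ∀ i, ∀ w ∈ End.eigenspace (x 0) μ, x (i + 2) w ∈ End.eigenspace (x 0) μ :=
        fun i ↦ hinv μ _ (hx.comm 0 (i + 2) (by omega)).symm
      have hsub : ∀ i < m - 2, ∀ w ∈ End.eigenspace (x 0) μ, x (i + 2) w = x (0 + 2) w := by
        intro i hi w hw
        have := ih _ (by omega) (End.eigenspace (x 0) μ) (m - 2) _ rfl (by omega)
          (hx.shift_two.restrict hWinv) i hi
        exact congrArg Subtype.val (LinearMap.congr_fun this ⟨w, hw⟩)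
      have h := glue (m - 2) (fun i ↦ x (i + 2)) _ hx.shift_two hm' hWinv (by omega) (by omega) hsub
        1 (by omega)
      exact hne (hx.eq_of_eq_succ (i := 2) (by omega) h.symm)
    rcases hge.lt_or_eq with hlt | heq
    · -- `x 0` is a scalar
      have htop : End.eigenspace (x 0) μ = ⊤ := Submodule.eq_top_of_finrank_eq (by omega)
      have hscalar : ∀ v, x 0 v = μ • v := fun v ↦
        End.mem_eigenspace_iff.1 (htop ▸ Submodule.mem_top)
      refine hne (hx.eq_of_eq_succ (i := 0) (by omega) (eq_of_braid_of_commute (hx.isUnit _)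
        (hx.isUnit _) (hx.braid 0 (by omega)) (LinearMap.ext fun v ↦ ?_)))
      simp [hscalar]
    -- the eigenspace is a hyperplane, so that all `x i - μ` have rank one
    have hR := isConjNatural_range_sub (V := V) μ
    have hrank : ∀ i < m, finrank K (LinearMap.range (x i - μ • (1 : End K V))) = 1 := by
      intro i hi
      rw [hx.finrank_apply_eq hR i hi]
      have := LinearMap.finrank_range_add_finrank_ker (x 0 - μ • (1 : End K V))
      have hk : LinearMap.ker (x 0 - μ • (1 : End K V)) = End.eigenspace (x 0) μ := by
        ext v
        simp [sub_eq_zero]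
      rw [hk] at this
      omega
    by_cases hR' : ∃ i j, i < j ∧ j < m ∧ LinearMap.range (x i - μ • (1 : End K V)) =
        LinearMap.range (x j - μ • (1 : End K V))
    · -- the common image is an invariant line, and the `x i` act as `μ` on its quotient
      obtain ⟨i, j, hij, hj, hRij⟩ := hR'
      have hall := hx.apply_eq_of_apply_eq (by omega) hR hij hj hRij
      beta_reduce at hall
      have hmem : ∀ i < m, ∀ v, x i v - μ • v ∈ LinearMap.range (x 0 - μ • (1 : End K V)) := by
        intro i hi v
        rw [← hall i hi]
        exact ⟨v, rfl⟩
      have hWinv : ∀ i, ∀ w ∈ LinearMap.range (x 0 - μ • (1 : End K V)),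
          x i w ∈ LinearMap.range (x 0 - μ • (1 : End K V)) := by
        intro i w hw
        rcases Nat.lt_or_ge i m with hi | hi
        · have := Submodule.add_mem _ (hmem i hi w) (Submodule.smul_mem _ μ hw)
          rwa [sub_add_cancel] at this
        · rwa [hx.eq_one i hi]
      refine hne (hx.eq_of_agree (by omega) (W := LinearMap.range (x 0 - μ • (1 : End K V)))
        (fun i hi w hw ↦ ?_) fun i hi v ↦ ?_)
      · have := (hx.restrict hWinv).eq_of_finrank_le_one (hrank 0 (by omega)).le i hi
        exact congrArg Subtype.val (LinearMap.congr_fun this ⟨w, hw⟩)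
      · have := Submodule.sub_mem _ (hmem i hi v) (hmem 0 (by omega) v)
        rwa [sub_sub_sub_cancel_right] at this
    · -- the images being distinct, the products `(x i - μ) * (x j - μ)` vanish for distant indices
      -- but not for neighbours, which is impossible as `m > d + 1`
      have hμ : μ ≠ 0 := by
        rintro rfl
        have hbot : End.eigenspace (x 0) (0 : K) = ⊥ := by
          rw [End.eigenspace_zero]
          exact (LinearMap.isUnit_iff_ker_eq_bot _).1 (hx.isUnit 0)
        rw [hbot, finrank_bot] at hk
        omega
      have := le_finrank_of_mul_eq_zero (m := m) (a := fun i ↦ x i - μ • (1 : End K V))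
        (fun i j hij hj ↦ ?_) fun i hi h0 ↦ ?_
      · omega
      · by_contra h0
        refine hR' ⟨i, j, by omega, hj, LinearMap.range_eq_range_of_commute_of_mul_ne_zero ?_
          (hrank i (by omega)) (hrank j hj) h0⟩
        have h1 : ∀ a : End K V, Commute a (μ • (1 : End K V)) := fun a ↦
          (Commute.one_right a).smul_right μ
        exact ((hx.comm i j hij).sub_left (h1 _).symm).sub_right ((h1 _).sub_left (h1 _).symm)
      · exact hR' ⟨i, i + 1, by omega, hi, range_sub_eq_of_braid hμ (hx.isUnit _) (hx.isUnit _)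
          (hx.braid i hi) h0⟩
  -- all eigenspaces are now lines or zero; one of `x 0` is preserved by `x 2` and `x 3`, acting by a
  -- common scalar `μ`, so that it is the `μ`-eigenspace of both, and thence of every `x i`
  have : Nontrivial V := nontrivial_of_finrank_pos (R := K) (by omega)
  obtain ⟨lam, hlam⟩ := End.exists_eigenvalue (x 0)
  have hE1 : finrank K (End.eigenspace (x 0) lam) = 1 :=
    le_antisymm (hone 0 (by omega) lam) (Submodule.one_le_finrank_iff.2 hlam)
  obtain ⟨⟨v, hvE⟩, hv0, hv⟩ := finrank_eq_one_iff'.1 hE1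
  have hx2 := hinv lam _ (hx.comm 0 2 le_rfl).symm
  obtain ⟨μ, hμ⟩ := hv ⟨x 2 v, hx2 v hvE⟩
  have hμ2 : x 2 v = μ • v := (congrArg Subtype.val hμ).symm
  have hμ3 : x 3 v = μ • v := by
    rw [← hμ2]
    have := (hx.shift_two.restrict fun i ↦ hinv lam _ (hx.comm 0 (i + 2) (by omega)).symm)
      |>.eq_of_finrank_le_one hE1.le 1 (by omega)
    exact congrArg Subtype.val (LinearMap.congr_fun this ⟨v, hvE⟩)
  have hle : ∀ i < m, x i v = μ • v → End.eigenspace (x 0) lam = End.eigenspace (x i) μ := by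
    intro i hi hi'
    refine Submodule.eq_of_le_of_finrank_le (fun w hw ↦ ?_) (hE1 ▸ hone i hi μ)
    obtain ⟨c, hc⟩ := hv ⟨w, hw⟩
    obtain rfl : c • v = w := congrArg Subtype.val hc
    exact Submodule.smul_mem _ c (End.mem_eigenspace_iff.2 hi')
  have h2 := hle 2 (by omega) hμ2
  have hall := hx.apply_eq_of_eq_succ (hnat μ) (i := 2) (by omega)
    (h2.symm.trans (hle 3 (by omega) hμ3))
  beta_reduce at hall
  have hW1 : finrank K (End.eigenspace (x 0) μ) = 1 := by
    rw [← hall 2 (by omega), ← h2, hE1]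
  have hact : ∀ i < m, ∀ w ∈ End.eigenspace (x 0) μ, x i w = μ • w := by
    intro i hi w hw
    rw [← hall i hi] at hw
    exact End.mem_eigenspace_iff.1 hw
  refine hne (glue m x (End.eigenspace (x 0) μ) hx (by omega) (fun i w hw ↦ ?_) (by omega)
    (by omega) fun i hi w hw ↦ ?_)
  · rcases Nat.lt_or_ge i m with hi | hi
    · rw [hact i hi w hw]
      exact Submodule.smul_mem _ μ hw
    · rwa [hx.eq_one i hi]
  · rw [hact i hi w hw, hact 0 (by omega) w hw]

end IsBraidTuple

end BraidTuples

/-! ### Representations of the braid groups -/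

section Groups

open Module

namespace Representation.IsIrreducible

theorem finrank_eq_one_of_commute {K G V : Type*} [Field K] [IsAlgClosed K] [Monoid G]
    [AddCommGroup V] [Module K V] [FiniteDimensional K V] {ρ : Representation K G V}
    (hρ : ρ.IsIrreducible) (hcomm : ∀ g h, Commute (ρ g) (ρ h)) : finrank K V = 1 := by
  have hscalar : ∀ g, ∃ c : K, ∀ v, ρ g v = c • v := by
    intro g
    obtain ⟨c, hc⟩ := (algebraMap_intertwiningMap_bijective_of_isAlgClosed (ρ := ρ)).2
      ⟨ρ g, fun h ↦ (hcomm g h).eq⟩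
    refine ⟨c, fun v ↦ ?_⟩
    have := DFunLike.congr_fun hc v
    exact this.symm
  have hnt : Nontrivial V := by
    by_contra hV
    rw [not_nontrivial_iff_subsingleton] at hV
    refine bot_ne_top (α := Subrepresentation ρ) ?_
    ext v
    simp [Subsingleton.elim v 0]
  obtain ⟨v, hv⟩ := exists_ne (0 : V)
  let W : Subrepresentation ρ :=
    { toSubmodule := K ∙ v
      apply_mem_toSubmodule := fun g w hw ↦ by
        obtain ⟨c, hc⟩ := hscalar g
        rw [hc]
        exact Submodule.smul_mem _ c hw }
  rcases eq_bot_or_eq_top W with hW | hW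
  · have : v ∈ (⊥ : Subrepresentation ρ) := hW ▸ Submodule.mem_span_singleton_self v
    exact absurd this hv
  · rw [finrank_eq_one_iff_of_nonzero v hv]
    exact congrArg Subrepresentation.toSubmodule hW

end Representation.IsIrreducible

theorem PresentedGroup.commute_map_of_commute_of {α M : Type*} [Monoid M]
    {rels : Set (FreeGroup α)} (φ : PresentedGroup rels →* M)
    (h : ∀ a b, Commute (φ (of a)) (φ (of b))) (g g' : PresentedGroup rels) :
    Commute (φ g) (φ g') := by
  have key : ∀ y : M, (∀ a, Commute (φ (of a)) y) → ∀ g, Commute (φ g) y := by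
    intro y hy g
    have hg : g ∈ Subgroup.closure (Set.range (of : α → PresentedGroup rels)) := by
      rw [closure_range_of]; trivial
    induction hg using Subgroup.closure_induction with
    | mem _ h => obtain ⟨a, rfl⟩ := h; exact hy a
    | one => rw [map_one]; exact Commute.one_left y
    | mul a b _ _ ha hb => rw [map_mul]; exact ha.mul_left hb
    | inv a _ ha =>
      have := (show Commute ((Units.map φ (toUnits a) : Mˣ) : M) y from ha).units_inv_left
      rwa [← map_inv, ← map_inv] at this
  exact key _ (fun a ↦ (key _ (fun b ↦ h b a) g').symm) g

theorem ArtinBraidGroup.commute_of_finrank {K : Type*} [Field K] [IsAlgClosed K] {V : Type u}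
    [AddCommGroup V] [Module K V] [FiniteDimensional K V] (n : ℕ)
    (ρ : Representation K (ArtinBraidGroup n) V) (hV : finrank K V + 3 ≤ n)
    (g h : ArtinBraidGroup n) : Commute (ρ g) (ρ h) := by
  let x : ℕ → End K V := fun i ↦ if hi : i < n - 1 then ρ (PresentedGroup.of ⟨i, hi⟩) else 1
  have hx : IsBraidTuple (n - 1) x :=
    { isUnit := fun i ↦ by
        by_cases hi : i < n - 1
        · simp only [x, dif_pos hi]
          exact (Group.isUnit _).map ρ
        · simp only [x, dif_neg hi]
          exact isUnit_one
      braid := fun i hi ↦ by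
        simp only [x, dif_pos hi, dif_pos (i.lt_succ_self.trans hi), ← map_mul]
        exact congrArg ρ (PresentedGroup.mk_eq_mk_of_mul_inv_mem (ArtinRel.braid _ _ rfl))
      comm := fun i j hij ↦ by
        by_cases hj : j < n - 1
        · have hi : i < n - 1 := by omega
          simp only [x, dif_pos hj, dif_pos hi]
          have hc : Commute (PresentedGroup.of ⟨i, hi⟩ : ArtinBraidGroup n)
              (PresentedGroup.of ⟨j, hj⟩) :=
            PresentedGroup.mk_eq_mk_of_mul_inv_mem (ArtinRel.comm ⟨i, hi⟩ ⟨j, hj⟩ hij)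
          exact hc.map ρ
        · simp only [x, dif_neg hj]
          exact Commute.one_right _
      eq_one := fun i hi ↦ dif_neg hi.not_gt }
  have heq := IsBraidTuple.eq_of_finrank_add_two_le _ V (n - 1) x rfl (by omega) hx
  have hof : ∀ i : Fin (n - 1), ρ (PresentedGroup.of i) = x 0 := by
    intro i
    rw [← heq i i.2]
    simp [x]
  refine PresentedGroup.commute_map_of_commute_of ρ (fun i j ↦ ?_) g h
  rw [hof, hof]
  exact Commute.refl _

/-- The generators `σ_0, …, σ_{n-2}` form a braid tuple of length `n - 1`, hence act equally;
conjugation by `τ` extends this to `σ_{n-1}` and shows that `τ` commutes with their common value. -/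
theorem NecklaceBraidGroup.commute_of_finrank {K : Type*} [Field K] [IsAlgClosed K] {V : Type u}
    [AddCommGroup V] [Module K V] [FiniteDimensional K V] (n : ℕ)
    (ρ : Representation K (NecklaceBraidGroup n) V) (hV : finrank K V + 3 ≤ n)
    (g h : NecklaceBraidGroup n) : Commute (ρ g) (ρ h) := by
  have hn : NeZero n := ⟨by omega⟩
  let s : ZMod n → NecklaceBraidGroup n := fun i ↦ PresentedGroup.of (NecklaceGen.sigma i)
  let t : NecklaceBraidGroup n := PresentedGroup.of NecklaceGen.tau
  have hbraid : ∀ i, s i * s (i + 1) * s i = s (i + 1) * s i * s (i + 1) := fun i ↦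
    PresentedGroup.mk_eq_mk_of_mul_inv_mem (NecklaceRel.braid i)
  have hcomm : ∀ i j : ZMod n, i - j ≠ 1 → j - i ≠ 1 → Commute (s i) (s j) := fun i j h₁ h₂ ↦
    PresentedGroup.mk_eq_mk_of_mul_inv_mem (NecklaceRel.comm i j h₁ h₂)
  have hconj : ∀ i, t * s i * t⁻¹ = s (i + 1) := fun i ↦
    PresentedGroup.mk_eq_mk_of_mul_inv_mem (NecklaceRel.conj i)
  let x : ℕ → End K V := fun i ↦ if i < n - 1 then ρ (s i) else 1
  have hx : IsBraidTuple (n - 1) x :=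
    { isUnit := fun i ↦ by
        by_cases hi : i < n - 1
        · simp only [x, if_pos hi]
          exact (Group.isUnit _).map ρ
        · simp only [x, if_neg hi]
          exact isUnit_one
      braid := fun i hi ↦ by
        simp only [x, if_pos hi, if_pos (i.lt_succ_self.trans hi), ← map_mul, Nat.cast_succ, hbraid]
      comm := fun i j hij ↦ by
        by_cases hj : j < n - 1
        · have hi : i < n - 1 := by omega
          simp only [x, if_pos hj, if_pos hi]
          refine Commute.map (hcomm _ _ ?_ ?_) ρ
          · intro h
            have h' : ((i : ℕ) : ZMod n) = ((j + 1 : ℕ) : ZMod n) := by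
              push_cast; linear_combination h
            rw [ZMod.natCast_eq_natCast_iff', Nat.mod_eq_of_lt (by omega),
              Nat.mod_eq_of_lt (by omega)] at h'
            omega
          · intro h
            have h' : ((j : ℕ) : ZMod n) = ((i + 1 : ℕ) : ZMod n) := by
              push_cast; linear_combination h
            rw [ZMod.natCast_eq_natCast_iff', Nat.mod_eq_of_lt (by omega),
              Nat.mod_eq_of_lt (by omega)] at h'
            omega
        · simp only [x, if_neg hj]
          exact Commute.one_right _
      eq_one := fun i hi ↦ if_neg hi.not_gt }
  have heq := IsBraidTuple.eq_of_finrank_add_two_le _ V (n - 1) x rfl (by omega) hx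
  have hs : ∀ i < n - 1, ρ (s i) = ρ (s 0) := by
    intro i hi
    have := heq i hi
    simpa only [x, if_pos hi, if_pos (show 0 < n - 1 by omega), Nat.cast_zero] using this
  have hs1 : ρ (s 1) = ρ (s 0) := by simpa using hs 1 (by omega)
  have hsall : ∀ i, ρ (s i) = ρ (s 0) := by
    intro i
    rw [← ZMod.natCast_zmod_val i]
    rcases Nat.lt_or_ge i.val (n - 1) with hi | hi
    · exact hs _ hi
    · -- the remaining generator is the `τ`-conjugate of its predecessor, just as `σ_1` is of `σ_0`
      have hval : i.val = n - 2 + 1 := by have := i.val_lt; omega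
      rw [hval, Nat.cast_succ, ← hconj, map_mul, map_mul, hs _ (by omega), ← map_mul, ← map_mul,
        hconj, zero_add, hs1]
  have hts : ∀ i, Commute (ρ t) (ρ (s i)) := by
    intro i
    have h0 : ρ t * ρ (s 0) = ρ (s 1) * ρ t := by
      rw [← map_mul, ← map_mul, ← zero_add (1 : ZMod n), ← hconj, inv_mul_cancel_right]
    rw [hsall i]
    rwa [hs1] at h0
  refine PresentedGroup.commute_map_of_commute_of ρ ?_ g h
  rintro (i | _) (j | _)
  · change Commute (ρ (s i)) (ρ (s j))
    rw [hsall i, hsall j]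
  · exact (hts i).symm
  · exact hts j
  · exact Commute.refl _

end Groups

theorem mainTheorem5 (n : ℕ) (hn : 5 ≤ n) :
    (∀ (V : Type*) [AddCommGroup V] [Module ℂ V] [FiniteDimensional ℂ V]
        (ρ : Representation ℂ (NecklaceBraidGroup n) V),
        ρ.IsIrreducible → Module.finrank ℂ V ≤ n - 3 → Module.finrank ℂ V = 1) ∧
      (∀ d : ℕ, 2 ≤ d → d ≤ n - 3 →
        ¬ IsIrreducibleDegree (NecklaceBraidGroup n) d ∧
          ¬ IsIrreducibleDegree (ArtinBraidGroup n) d) := by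
  refine ⟨fun V _ _ _ ρ hρ hV ↦ hρ.finrank_eq_one_of_commute
    (NecklaceBraidGroup.commute_of_finrank n ρ (by omega)), fun d hd hdn ↦ ⟨?_, ?_⟩⟩
  · rintro ⟨ρ, hρ⟩
    have := hρ.finrank_eq_one_of_commute
      (NecklaceBraidGroup.commute_of_finrank n ρ (by rw [Module.finrank_fin_fun]; omega))
    rw [Module.finrank_fin_fun] at this
    omega
  · rintro ⟨ρ, hρ⟩
    have := hρ.finrank_eq_one_of_commute
      (ArtinBraidGroup.commute_of_finrank n ρ (by rw [Module.finrank_fin_fun]; omega))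
    rw [Module.finrank_fin_fun] at this
    omega
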